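/- Let $X$ be a compact metric space with Borel $\sigma$-algebra $\mathcal B_X$, let $T$ be an action of $\mathbb Z^2$ on $X$ by homeomorphisms $T^{(m,n)}$, and let $\mu$ be a $T$-invariant Borel probability measure on $X$. Let $\beta\in\mathbb R$ and $\vec v=(1,\beta)$. For $b>0$ and $k\ge 1$ put $$\Lambda^{\vec v}(b)=\{(m,n)\in\mathbb Z^2:\ \beta m-b/2\le n\le \beta m+b/2\},\qquad \Lambda^{\vec v}_k(b)=\Lambda^{\vec v}(b)\cap([0,k-1]\times\mathbb Z).$$ On the complex Hilbert space $L^2(X,\mathcal B_X,\mu)$ with $\langle f,g\rangle=\int f\overline g\,d\mu$, write $T^{(m,n)}f=f\circ T^{(m,n)}$. Fix $b_0>0$, and let $\mathcal K^{\vec v}_\mu$ be the collection of all $B\in\mathcal B_X$ for which the closure of $\{T^{(m,n)}1_B:(m,n)\in\Lambda^{\vec v}(b_0)\}$ in $L^2(X,\mathcal B_X,\mu)$ is compact. The system is called $\vec v$-weak mixing if $\mathcal K^{\vec v}_\mu=\{X,\emptyset\}$ modulo $\mu$-null sets, i.e. every $B\in\mathcal K^{\vec v}_\mu$ has $\mu(B)\in\{0,1\}$.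 Theorem. For every $b_0>0$ (used in the definition of $\mathcal K^{\vec v}_\mu$) and every $b>0$, the following are equivalent: (a) $(X,\mathcal B_X,\mu,T)$ is $\vec v$-weak mixing. (b) For every $f\in L^2(X,\mathcal B_X,\mu)$, $$\lim_{k\to\infty}\frac1{\#\Lambda_k^{\vec v}(b)}\sum_{(m,n)\in\Lambda_k^{\vec v}(b)}\bigl|\langle T^{(m,n)}f,f\rangle-\langle f,1\rangle\langle 1,f\rangle\bigr|=0.$$ (c) For all $f,g\in L^2(X,\mathcal B_X,\mu)$, $$\lim_{k\to\infty}\frac1{\#\Lambda_k^{\vec v}(b)}\sum_{(m,n)\in\Lambda_k^{\vec v}(b)}\bigl|\langle T^{(m,n)}f,g\rangle-\langle f,1\rangle\langle 1,g\rangle\bigr|=0.$$ -/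

import Mathlib

open MeasureTheory Filter Topology
open scoped ENNReal

namespace DirectionalWeakMixing

/-- A `ℤ²`-topological dynamical system on `X`: a homomorphism from the additive group `ℤ²` to the
group of homeomorphisms of `X`. -/
abbrev ZTwoAction (X : Type*) [TopologicalSpace X] : Type _ :=
  Multiplicative (ℤ × ℤ) →* (X ≃ₜ X)

/-- The homeomorphism `T^(m,n)`. -/
def ZTwoAction.at {X : Type*} [TopologicalSpace X] (T : ZTwoAction X) (p : ℤ × ℤ) : X ≃ₜ X :=
  T (Multiplicative.ofAdd p)

/-- `μ` is invariant: `μ (T^(-p) A) = μ A` for all `p ∈ ℤ²` and all measurable `A`, where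
`T^(-p) A` is the preimage of `A` under `T^p`. -/
def IsInvariant {X : Type*} [TopologicalSpace X] [MeasurableSpace X]
    (T : ZTwoAction X) (μ : Measure X) : Prop :=
  ∀ (p : ℤ × ℤ) (A : Set X), MeasurableSet A → μ (T.at p ⁻¹' A) = μ A

theorem IsInvariant.measurePreserving {X : Type*} [TopologicalSpace X] [MeasurableSpace X]
    [BorelSpace X] {T : ZTwoAction X} {μ : Measure X} (h : IsInvariant T μ) (p : ℤ × ℤ) :
    MeasurePreserving (T.at p) μ μ := by
  refine ⟨(T.at p).continuous.measurable, ?_⟩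
  ext A hA
  rw [Measure.map_apply (T.at p).continuous.measurable hA, h p A hA]

section Koopman

variable {X : Type*} [TopologicalSpace X] [MeasurableSpace X] [BorelSpace X]

/-- The Koopman operator `U_T^p f = f ∘ T^p` on the complex Hilbert space `L²(X, μ)`. -/
noncomputable def koopman {T : ZTwoAction X} {μ : Measure X} (h : IsInvariant T μ) (p : ℤ × ℤ) :
    Lp ℂ 2 μ →ₗᵢ[ℂ] Lp ℂ 2 μ :=
  Lp.compMeasurePreservingₗᵢ ℂ (T.at p) (h.measurePreserving p)

end Koopman

/-- The inner product `⟨f, g⟩ = ∫ f * conj g dμ` of `L²(X, μ)`, linear in the first variable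
(Mathlib's `inner` is linear in the second one). -/
noncomputable def pairing {X : Type*} [MeasurableSpace X] {μ : Measure X} (f g : Lp ℂ 2 μ) : ℂ :=
  inner ℂ g f

/-- The strip `Λ(b)` of width `b > 0` in the direction `(1, β)`. -/
def strip (β b : ℝ) : Set (ℤ × ℤ) :=
  {p | β * p.1 - b / 2 ≤ p.2 ∧ (p.2 : ℝ) ≤ β * p.1 + b / 2}

theorem finite_strip_inter (β b : ℝ) (k : ℕ) :
    (strip β b ∩ (Set.Icc (0 : ℤ) ((k : ℤ) - 1) ×ˢ Set.univ)).Finite := by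
  refine ((Set.finite_Icc (0 : ℤ) ((k : ℤ) - 1)).biUnion
    (t := fun m => (fun n : ℤ => (m, n)) '' Set.Icc ⌈β * m - b / 2⌉ ⌊β * m + b / 2⌋)
    (fun m _ => (Set.finite_Icc _ _).image _)).subset ?_
  rintro ⟨m, n⟩ ⟨⟨h₁, h₂⟩, hm, -⟩
  exact Set.mem_biUnion hm ⟨n, ⟨Int.ceil_le.2 h₁, Int.le_floor.2 h₂⟩, rfl⟩

/-- The finite set `Λ_k(b) = Λ(b) ∩ ([0, k-1] × ℤ)`. -/
noncomputable def stripTrunc (β b : ℝ) (k : ℕ) : Finset (ℤ × ℤ) :=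
  (finite_strip_inter β b k).toFinset

/-- The average of `a` over `Λ_k(b)`. -/
noncomputable def stripAverage (β b : ℝ) (a : ℤ × ℤ → ℝ) (k : ℕ) : ℝ :=
  (1 / ((stripTrunc β b k).card : ℝ)) * ∑ p ∈ stripTrunc β b k, a p

section Kronecker

variable {X : Type*} [TopologicalSpace X] [MeasurableSpace X] [BorelSpace X]
  {T : ZTwoAction X} {μ : Measure X} [IsFiniteMeasure μ]

/-- The directional Kronecker algebra in the direction `(1, β)`, computed with the strip of
width `b`: the measurable sets `B` for which the orbit of `1_B` along `Λ(b)` has compact closure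
in `L²(X, μ)`. -/
def kroneckerAlgebra (h : IsInvariant T μ) (β b : ℝ) : Set (Set X) :=
  {B | ∃ hB : MeasurableSet B, IsCompact (closure
    ((fun p => koopman h p (indicatorConstLp 2 hB (measure_ne_top μ B) (1 : ℂ))) '' strip β b))}

/-- Weak mixing in the direction `(1, β)`: the directional Kronecker algebra is `{X, ∅}`, as an
equality of `σ`-algebras modulo `μ`-null sets (the inclusion of `∅` and `X` is automatic). -/
def IsDirWeakMixing (h : IsInvariant T μ) (β b : ℝ) : Prop :=
  ∀ B ∈ kroneckerAlgebra h β b, B =ᵐ[μ] (∅ : Set X) ∨ B =ᵐ[μ] (Set.univ : Set X)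

end Kronecker

end DirectionalWeakMixing

/-!
If the correlations of `f` along the strip do not average to `0`, then, testing against weights
that are bounded in `ℓ¹` and almost invariant under translation by lattice points close to the line
of slope `β`, a weak limit `A` of the weighted sums of the rank one operators `⟨U p f, ·⟩ U p f`
satisfies `⟨A f, f⟩ ≠ 0`. It is Hilbert–Schmidt and almost commutes with `U p` for `p` close to the
line, and finitely many translates of a thin strip cover a thick one; so `A f` has a totally bounded
orbit along the strip. Composing such a vector of `L²` with functions approximating the indicator
function of an open set not containing `0` shows that the preimage of the open set lies in the
Kronecker algebra, so the vector is constant if the system is directionally weakly mixing. Hence a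
function of mean zero, being orthogonal to the constants, has correlations averaging to `0`, and
polarization passes from one function to two. Conversely, a vector with a totally bounded orbit
whose correlations with all vectors average to `0` vanishes, as finitely many vectors detect the
norm of the whole orbit.
-/

namespace DirectionalWeakMixing

section HilbertSchmidt

open InnerProductSpace

variable {𝕜 H : Type*} [RCLike 𝕜] [NormedAddCommGroup H] [InnerProductSpace 𝕜 H]

theorem norm_sum_rankOne_le {ι : Type*} {v : ι → H} (hv : Orthonormal 𝕜 v) (u : ι → H)
    (t : Finset ι) : ‖∑ i ∈ t, rankOne 𝕜 (u i) (v i)‖ ≤ √(∑ i ∈ t, ‖u i‖ ^ 2) := by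
  refine ContinuousLinearMap.opNorm_le_bound _ (Real.sqrt_nonneg _) fun x => ?_
  calc ‖(∑ i ∈ t, rankOne 𝕜 (u i) (v i)) x‖
    _ = ‖∑ i ∈ t, inner 𝕜 (v i) x • u i‖ := by
        simp only [sum_apply, rankOne_apply]
    _ ≤ ∑ i ∈ t, ‖u i‖ * ‖inner 𝕜 (v i) x‖ := by
        refine (norm_sum_le _ _).trans_eq (Finset.sum_congr rfl fun i _ => ?_)
        rw [norm_smul, mul_comm]
    _ ≤ √(∑ i ∈ t, ‖u i‖ ^ 2) * √(∑ i ∈ t, ‖inner 𝕜 (v i) x‖ ^ 2) :=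
        Real.sum_mul_le_sqrt_mul_sqrt _ _ _
    _ ≤ √(∑ i ∈ t, ‖u i‖ ^ 2) * ‖x‖ := by
        gcongr
        exact (Real.sqrt_le_left (norm_nonneg x)).2 (hv.sum_inner_products_le x)

theorem isCompactOperator_rankOne (x y : H) : IsCompactOperator (rankOne 𝕜 x y) :=
  (isCompactOperator_of_locallyCompactSpace_rng
    (ContinuousLinearMap.toSpanSingleton 𝕜 x)).comp_clm (innerSL 𝕜 y)

/-- The images of the vectors `v i`, `i ∈ s`, under an operator, as an element of the `ℓ²` direct
sum. If `v` is a Hilbert basis, the norms of all `columns v s A` are bounded by a constant if and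
only if `A` is a Hilbert–Schmidt operator. -/
noncomputable def columns {ι : Type*} (v : ι → H) (s : Finset ι) :
    (H →L[𝕜] H) →ₗ[𝕜] PiLp 2 fun _ : s => H where
  toFun A := WithLp.toLp 2 fun i => A (v i)
  map_add' _ _ := rfl
  map_smul' _ _ := rfl

theorem norm_columns_sq {ι : Type*} (v : ι → H) (s : Finset ι) (A : H →L[𝕜] H) :
    ‖columns v s A‖ ^ 2 = ∑ i ∈ s, ‖A (v i)‖ ^ 2 := by
  rw [PiLp.norm_sq_eq_of_L2, ← Finset.sum_coe_sort s]
  rfl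

theorem norm_columns_rankOne_le {ι : Type*} {v : ι → H} (hv : Orthonormal 𝕜 v) (s : Finset ι)
    (x y : H) : ‖columns v s (rankOne 𝕜 x y)‖ ≤ ‖x‖ * ‖y‖ := by
  refine abs_le_of_sq_le_sq' ?_ (by positivity) |>.2
  calc ‖columns v s (rankOne 𝕜 x y)‖ ^ 2 = ‖x‖ ^ 2 * ∑ i ∈ s, ‖inner 𝕜 (v i) y‖ ^ 2 := by
        simp only [norm_columns_sq, rankOne_apply, norm_smul, norm_inner_symm y, mul_pow,
          Finset.mul_sum, mul_comm]
    _ ≤ ‖x‖ ^ 2 * ‖y‖ ^ 2 := by gcongr; exact hv.sum_inner_products_le y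
    _ = (‖x‖ * ‖y‖) ^ 2 := (mul_pow _ _ _).symm

theorem isCompactOperator_of_norm_columns_le [CompleteSpace H] {ι : Type*}
    (b : HilbertBasis ι 𝕜 H) {A : H →L[𝕜] H} {C : ℝ} (hA : ∀ s, ‖columns b s A‖ ≤ C) :
    IsCompactOperator A := by
  have summable_norm_sq : Summable fun i => ‖A (b i)‖ ^ 2 :=
    summable_of_sum_le (fun _ => by positivity) fun s =>
      (norm_columns_sq b s A).ge.trans (pow_le_pow_left₀ (norm_nonneg _) (hA s) 2)
  set R : ι → H →L[𝕜] H := fun i => rankOne 𝕜 (A (b i)) (b i) with hR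
  have summable_R : Summable R := by
    refine summable_iff_vanishing_norm.2 fun ε hε => ?_
    obtain ⟨s, hs⟩ := summable_iff_vanishing_norm.1 summable_norm_sq (ε ^ 2) (by positivity)
    refine ⟨s, fun t ht => (norm_sum_rankOne_le b.orthonormal _ t).trans_lt ?_⟩
    exact (Real.sqrt_lt' hε).2 ((le_abs_self _).trans_lt (hs t ht))
  have hasSum_R : HasSum R A := by
    convert summable_R.hasSum using 1
    ext x
    have hx : HasSum (fun i => R i x) (A x) := by
      simpa only [hR, rankOne_apply, b.repr_apply_apply, map_smul] using
        (b.hasSum_repr x).mapL A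
    exact hx.unique (summable_R.hasSum.mapL (ContinuousLinearMap.apply 𝕜 H x))
  refine isCompactOperator_of_tendsto hasSum_R (Eventually.of_forall fun s => ?_)
  exact (compactOperator (RingHom.id 𝕜) H H).sum_mem fun i _ => isCompactOperator_rankOne _ _

end HilbertSchmidt

section WeakLimits

variable {𝕜 H ι : Type*} [RCLike 𝕜] [NormedAddCommGroup H] [InnerProductSpace 𝕜 H]

theorem norm_le_of_tendsto_inner {l : Filter ι} [l.NeBot] {y : ι → H} {z : H}
    (hyz : ∀ x, Tendsto (fun i => inner 𝕜 (y i) x) l (𝓝 (inner 𝕜 z x))) {c : ℝ}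
    (hy : ∀ᶠ i in l, ‖y i‖ ≤ c) : ‖z‖ ≤ c := by
  have hc : 0 ≤ c := hy.exists.elim fun i hi => (norm_nonneg _).trans hi
  have norm_inner_self : ‖inner 𝕜 z z‖ = ‖z‖ * ‖z‖ := by simp [inner_self_eq_norm_sq_to_K, sq]
  have mul_norm_le : ‖z‖ * ‖z‖ ≤ c * ‖z‖ := by
    refine norm_inner_self ▸ le_of_tendsto (hyz z).norm (hy.mono fun i hi => ?_)
    exact (norm_inner_le_norm _ _).trans (by gcongr)
  rcases (norm_nonneg z).eq_or_lt with hz | hz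
  · exact hz ▸ hc
  · exact le_of_mul_le_mul_right mul_norm_le hz

theorem exists_tendsto_inner_of_norm_le [CompleteSpace H] (𝒰 : Ultrafilter ι) {y : ι → H} {C : ℝ}
    (hy : ∀ i, ‖y i‖ ≤ C) :
    ∃ z : H, ∀ x, Tendsto (fun i => inner 𝕜 (y i) x) 𝒰 (𝓝 (inner 𝕜 z x)) := by
  let φ : ι → WeakDual 𝕜 H := fun i => StrongDual.toWeakDual (InnerProductSpace.toDual 𝕜 H (y i))
  obtain ⟨ψ, -, hψ⟩ := (WeakDual.isCompact_closedBall (0 : StrongDual 𝕜 H) C).ultrafilter_le_nhds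
    (𝒰.map φ) (tendsto_principal.2 (Eventually.of_forall fun i => by simp [φ, hy]))
  refine ⟨(InnerProductSpace.toDual 𝕜 H).symm (WeakDual.toStrongDual ψ), fun x => ?_⟩
  rw [InnerProductSpace.toDual_symm_apply]
  exact ((WeakDual.eval_continuous x).tendsto ψ).comp hψ

theorem exists_clm_tendsto_inner_of_norm_le [CompleteSpace H] (𝒰 : Ultrafilter ι)
    {A : ι → H →L[𝕜] H} {C : ℝ} (hA : ∀ i, ‖A i‖ ≤ C) :
    ∃ B : H →L[𝕜] H, ∀ x y, Tendsto (fun i => inner 𝕜 (A i x) y) 𝒰 (𝓝 (inner 𝕜 (B x) y)) := by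
  have norm_apply_le (x : H) (i : ι) : ‖A i x‖ ≤ C * ‖x‖ := (A i).le_of_opNorm_le (hA i) x
  choose B hB using fun x => exists_tendsto_inner_of_norm_le (𝕜 := 𝕜) 𝒰 (norm_apply_le x)
  let B' : H →ₗ[𝕜] H :=
    { toFun := B
      map_add' := fun x x' => ext_inner_right 𝕜 fun y => tendsto_nhds_unique (hB _ y) <| by
        simpa only [map_add, inner_add_left] using (hB x y).add (hB x' y)
      map_smul' := fun c x => ext_inner_right 𝕜 fun y => tendsto_nhds_unique (hB _ y) <| by
        simpa only [map_smul, inner_smul_left, RingHom.id_apply] using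
          (hB x y).const_mul (starRingEnd 𝕜 c) }
  exact ⟨B'.mkContinuous C fun x => norm_le_of_tendsto_inner (hB x)
    (Eventually.of_forall (norm_apply_le x)), hB⟩

theorem norm_columns_le_of_tendsto_inner {κ : Type*} {l : Filter ι} [l.NeBot] {A : ι → H →L[𝕜] H}
    {B : H →L[𝕜] H} (hAB : ∀ x y, Tendsto (fun i => inner 𝕜 (A i x) y) l (𝓝 (inner 𝕜 (B x) y)))
    {v : κ → H} {s : Finset κ} {C : ℝ} (hA : ∀ i, ‖columns v s (A i)‖ ≤ C) :
    ‖columns v s B‖ ≤ C :=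
  norm_le_of_tendsto_inner (𝕜 := 𝕜) (l := l) (y := fun i => columns v s (A i))
    (fun x => by simpa only [PiLp.inner_apply] using! tendsto_finsetSum _ fun j _ => hAB _ (x j))
    (Eventually.of_forall hA)

end WeakLimits

section AlmostPeriodic

open scoped Pointwise

theorem totallyBounded_of_forall_approx {E : Type*} [PseudoMetricSpace E] {s : Set E}
    (h : ∀ ε > 0, ∃ t : Set E, TotallyBounded t ∧ ∀ x ∈ s, ∃ y ∈ t, dist x y < ε) :
    TotallyBounded s := by
  refine Metric.totallyBounded_iff.2 fun ε hε => ?_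
  obtain ⟨t, ht, hst⟩ := h (ε / 2) (half_pos hε)
  obtain ⟨F, hF, hcov⟩ := Metric.totallyBounded_iff.1 ht (ε / 2) (half_pos hε)
  refine ⟨F, hF, fun x hx => ?_⟩
  obtain ⟨y, hy, hxy⟩ := hst x hx
  obtain ⟨z, hz, hyz⟩ := Set.mem_iUnion₂.1 (hcov hy)
  refine Set.mem_iUnion₂.2 ⟨z, hz, (dist_triangle x y z).trans_lt ?_⟩
  linarith [Metric.mem_ball.1 hyz]

variable {𝕜 H G : Type*} [RCLike 𝕜] [NormedAddCommGroup H] [InnerProductSpace 𝕜 H] [AddMonoid G]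
  {U : AddChar G (H →ₗᵢ[𝕜] H)} {S S' : Set G} {x : H}

/-- A vector is almost periodic along a set `S` of group elements if its orbit along `S` is
totally bounded. -/
def IsAlmostPeriodicOn (U : AddChar G (H →ₗᵢ[𝕜] H)) (S : Set G) (x : H) : Prop :=
  TotallyBounded ((fun p => U p x) '' S)

theorem addChar_add_apply (U : AddChar G (H →ₗᵢ[𝕜] H)) (p q : G) (x : H) :
    U (p + q) x = U p (U q x) := by
  rw [U.map_add_eq_mul, LinearIsometry.coe_mul, Function.comp_apply]

theorem IsAlmostPeriodicOn.of_subset_add (hx : IsAlmostPeriodicOn U S' x) {F : Finset G}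
    (hS : S ⊆ F + S') : IsAlmostPeriodicOn U S x := by
  have totallyBounded_translates :
      TotallyBounded (⋃ q ∈ F, U q '' ((fun p => U p x) '' S')) :=
    (totallyBounded_biUnion F.finite_toSet).2 fun q _ => hx.image (U q).isometry.uniformContinuous
  refine totallyBounded_translates.subset ?_
  rintro _ ⟨p, hp, rfl⟩
  obtain ⟨q, hq, r, hr, rfl⟩ := Set.mem_add.1 (hS hp)
  exact Set.mem_biUnion hq ⟨_, ⟨r, hr, rfl⟩, (addChar_add_apply U q r x).symm⟩

theorem IsAlmostPeriodicOn.map (hx : IsAlmostPeriodicOn U S x) {Φ : H → H}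
    (hΦ : UniformContinuous Φ) (hU : ∀ p ∈ S, U p (Φ x) = Φ (U p x)) :
    IsAlmostPeriodicOn U S (Φ x) := by
  rw [IsAlmostPeriodicOn, Set.image_congr hU, ← Set.image_image]
  exact TotallyBounded.image hx hΦ

theorem IsAlmostPeriodicOn.of_tendsto {ι : Type*} {l : Filter ι} [l.NeBot] {y : ι → H}
    (hy : ∀ i, IsAlmostPeriodicOn U S (y i)) (hyx : Tendsto y l (𝓝 x)) :
    IsAlmostPeriodicOn U S x := by
  refine totallyBounded_of_forall_approx fun ε hε => ?_
  obtain ⟨i, hi⟩ := (hyx.eventually (Metric.ball_mem_nhds x hε)).exists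
  refine ⟨_, hy i, ?_⟩
  rintro _ ⟨p, hp, rfl⟩
  exact ⟨_, ⟨p, hp, rfl⟩, by rwa [(U p).isometry.dist_eq, dist_comm]⟩

theorem isAlmostPeriodicOn_of_isCompactOperator {A : H →L[𝕜] H} (hA : IsCompactOperator A)
    (hAU : ∀ ε > 0, ∃ (F : Finset G) (S' : Set G), S ⊆ F + S' ∧
      ∀ r ∈ S', ‖U r (A x) - A (U r x)‖ < ε) :
    IsAlmostPeriodicOn U S (A x) := by
  have totallyBounded_image : TotallyBounded (A '' Metric.closedBall 0 ‖x‖) :=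
    (hA.isCompact_closure_image_closedBall ‖x‖).totallyBounded.subset subset_closure
  refine totallyBounded_of_forall_approx fun ε hε => ?_
  obtain ⟨F, S', hS, hcomm⟩ := hAU ε hε
  refine ⟨⋃ q ∈ F, U q '' (A '' Metric.closedBall 0 ‖x‖), (totallyBounded_biUnion F.finite_toSet).2
    fun q _ => totallyBounded_image.image (U q).isometry.uniformContinuous, ?_⟩
  rintro _ ⟨p, hp, rfl⟩
  obtain ⟨q, hq, r, hr, rfl⟩ := Set.mem_add.1 (hS hp)
  refine ⟨U q (A (U r x)), Set.mem_biUnion hq ⟨_, ⟨U r x, by simp, rfl⟩, rfl⟩, ?_⟩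
  simp only [addChar_add_apply, (U q).isometry.dist_eq, dist_eq_norm]
  exact hcomm r hr

theorem IsAlmostPeriodicOn.exists_finset_le_sum_norm_inner (hx : IsAlmostPeriodicOn U S x) :
    ∃ t : Finset H, ∀ p ∈ S, ‖x‖ ^ 2 / 2 ≤ ∑ y ∈ t, ‖inner 𝕜 y (U p x)‖ := by
  rcases eq_or_ne x 0 with rfl | hx0
  · exact ⟨∅, by simp⟩
  obtain ⟨t, ht, hcov⟩ := Metric.totallyBounded_iff.1 hx (‖x‖ / 2) (by positivity)
  refine ⟨ht.toFinset, fun p hp => ?_⟩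
  obtain ⟨y, hy, hpy⟩ := Set.mem_iUnion₂.1 (hcov ⟨p, hp, rfl⟩)
  rw [Metric.mem_ball, dist_eq_norm] at hpy
  have norm_sq_le : ‖x‖ ^ 2 ≤ ‖inner 𝕜 y (U p x)‖ + ‖x‖ / 2 * ‖x‖ := by
    calc ‖x‖ ^ 2 = ‖inner 𝕜 (U p x) (U p x)‖ := by
          rw [LinearIsometry.inner_map_map, inner_self_eq_norm_sq_to_K]; simp
      _ = ‖inner 𝕜 y (U p x) + inner 𝕜 (U p x - y) (U p x)‖ := by
          rw [← inner_add_left, add_sub_cancel]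
      _ ≤ ‖inner 𝕜 y (U p x)‖ + ‖U p x - y‖ * ‖U p x‖ :=
          (norm_add_le _ _).trans (by gcongr; exact norm_inner_le_norm _ _)
      _ ≤ ‖inner 𝕜 y (U p x)‖ + ‖x‖ / 2 * ‖x‖ := by
          rw [LinearIsometry.norm_map]; gcongr
  have le_sum := Finset.single_le_sum (f := fun y => ‖inner 𝕜 y (U p x)‖)
    (fun _ _ => norm_nonneg _) (ht.mem_toFinset.2 hy)
  linarith

end AlmostPeriodic

section OrbitOperator

open InnerProductSpace
open scoped Pointwise

/-- The `ℓ¹` norm of a finitely supported weight. -/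
noncomputable def l1Norm {G : Type*} (w : G →₀ ℝ) : ℝ :=
  w.sum fun _ c => |c|

theorem l1Norm_le_card_mul {G : Type*} {w : G →₀ ℝ} {s : Finset G} (hs : w.support ⊆ s) {ε : ℝ}
    (hw : ∀ p, |w p| ≤ ε) : l1Norm w ≤ s.card * ε := by
  rw [l1Norm, Finsupp.sum_of_support_subset _ hs _ (by simp)]
  exact (Finset.sum_le_card_nsmul _ _ _ fun p _ => hw p).trans_eq (nsmul_eq_mul _ _)

theorem norm_linearCombination_le {G E : Type*} [SeminormedAddCommGroup E] [NormedSpace ℝ E]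
    {v : G → E} {C : ℝ} (hv : ∀ p, ‖v p‖ ≤ C) (w : G →₀ ℝ) :
    ‖Finsupp.linearCombination ℝ v w‖ ≤ C * l1Norm w := by
  rw [Finsupp.linearCombination_apply, l1Norm, Finsupp.sum, Finsupp.sum, Finset.mul_sum]
  refine norm_sum_le_of_le _ fun p _ => ?_
  rw [norm_smul, Real.norm_eq_abs, mul_comm]
  gcongr
  exact hv p

variable {G H : Type*} [AddMonoid G] [NormedAddCommGroup H] [InnerProductSpace ℂ H]

/-- The weighted sum `∑ p, w p • ⟨U p f, ·⟩ U p f` of the rank one operators of an orbit. -/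
noncomputable def orbitOperator (U : AddChar G (H →ₗᵢ[ℂ] H)) (f : H) :
    (G →₀ ℝ) →ₗ[ℝ] (H →L[ℂ] H) :=
  Finsupp.linearCombination ℝ fun p => rankOne ℂ (U p f) (U p f)

variable (U : AddChar G (H →ₗᵢ[ℂ] H)) (f : H)

theorem norm_orbitOperator_le (w : G →₀ ℝ) : ‖orbitOperator U f w‖ ≤ ‖f‖ ^ 2 * l1Norm w :=
  norm_linearCombination_le (fun p => by simp [sq]) w

theorem orbitOperator_apply (w : G →₀ ℝ) (x : H) :
    orbitOperator U f w x = w.sum fun p c => c • inner ℂ (U p f) x • U p f := by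
  simp only [orbitOperator, Finsupp.linearCombination_apply, Finsupp.sum, sum_apply,
    smul_apply, rankOne_apply]

theorem norm_columns_orbitOperator_le {κ : Type*} {v : κ → H} (hv : Orthonormal ℂ v)
    (s : Finset κ) (w : G →₀ ℝ) :
    ‖columns v s (orbitOperator U f w)‖ ≤ ‖f‖ ^ 2 * l1Norm w := by
  have columns_orbitOperator : columns v s (orbitOperator U f w) =
      Finsupp.linearCombination ℝ (fun p => columns v s (rankOne ℂ (U p f) (U p f))) w :=
    Finsupp.apply_linearCombination ℝ ((columns v s).restrictScalars ℝ) _ w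
  rw [columns_orbitOperator]
  refine norm_linearCombination_le (fun p => (norm_columns_rankOne_le hv s _ _).trans_eq ?_) w
  rw [LinearIsometry.norm_map, sq]

theorem inner_orbitOperator_self (w : G →₀ ℝ) :
    inner ℂ (orbitOperator U f w f) f = (w.sum fun p c => c * ‖inner ℂ (U p f) f‖ ^ 2 : ℝ) := by
  simp only [orbitOperator_apply, Finsupp.sum, sum_inner, Complex.ofReal_sum]
  refine Finset.sum_congr rfl fun p _ => ?_
  rw [inner_smul_left_eq_smul, inner_smul_left, RCLike.conj_mul, Complex.real_smul]
  push_cast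
  rfl

theorem apply_orbitOperator_apply (r : G) (w : G →₀ ℝ) (x : H) :
    U r (orbitOperator U f w x) = orbitOperator U f (w.mapDomain (r + ·)) (U r x) := by
  rw [orbitOperator_apply, orbitOperator, Finsupp.linearCombination_mapDomain,
    Finsupp.linearCombination_apply, Finsupp.sum, Finsupp.sum, map_sum, sum_apply]
  refine Finset.sum_congr rfl fun p _ => ?_
  simp only [map_real_smul (U r) (U r).continuous, map_smul, Function.comp_apply, smul_apply,
    rankOne_apply, addChar_add_apply, LinearIsometry.inner_map_map]

theorem norm_apply_orbitOperator_sub_le (r : G) (w : G →₀ ℝ) (x : H) :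
    ‖U r (orbitOperator U f w x) - orbitOperator U f w (U r x)‖ ≤
      ‖f‖ ^ 2 * l1Norm (w.mapDomain (r + ·) - w) * ‖x‖ := by
  rw [apply_orbitOperator_apply, ← sub_apply, ← map_sub]
  exact (ContinuousLinearMap.le_of_opNorm_le _ (norm_orbitOperator_le U f _) _).trans_eq
    (by rw [LinearIsometry.norm_map])

variable {U f} [CompleteSpace H] {ι : Type*} {w : ι → G →₀ ℝ}

theorem isCompactOperator_of_tendsto_inner_orbitOperator {l : Filter ι} [l.NeBot]
    {A : H →L[ℂ] H} {D : ℝ} (hw : ∀ i, l1Norm (w i) ≤ D)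
    (hA : ∀ x y, Tendsto (fun i => inner ℂ (orbitOperator U f (w i) x) y) l (𝓝 (inner ℂ (A x) y))) :
    IsCompactOperator A := by
  obtain ⟨κ, b, -⟩ := exists_hilbertBasis ℂ H
  refine isCompactOperator_of_norm_columns_le b (C := ‖f‖ ^ 2 * D) fun s => ?_
  refine norm_columns_le_of_tendsto_inner hA fun i => ?_
  refine (norm_columns_orbitOperator_le U f b.orthonormal s (w i)).trans ?_
  gcongr
  exact hw i

theorem norm_apply_sub_le_of_tendsto_inner_orbitOperator {l : Filter ι} [l.NeBot]
    {A : H →L[ℂ] H} {r : G} {ε : ℝ} (hw : ∀ᶠ i in l, l1Norm ((w i).mapDomain (r + ·) - w i) ≤ ε)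
    (hA : ∀ x y, Tendsto (fun i => inner ℂ (orbitOperator U f (w i) x) y) l (𝓝 (inner ℂ (A x) y)))
    (x : H) : ‖U r (A x) - A (U r x)‖ ≤ ‖f‖ ^ 2 * ε * ‖x‖ := by
  refine norm_le_of_tendsto_inner (𝕜 := ℂ) (l := l)
    (y := fun i => U r (orbitOperator U f (w i) x) - orbitOperator U f (w i) (U r x))
    (fun z => ?_) ?_
  · have inner_apply (y : H) : inner ℂ (U r y) z =
        inner ℂ y (ContinuousLinearMap.adjoint (U r).toContinuousLinearMap z) :=
      ((U r).toContinuousLinearMap.adjoint_inner_right y z).symm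
    simp only [inner_sub_left, inner_apply]
    exact (hA _ _).sub (hA _ _)
  · filter_upwards [hw] with i hi
    refine (norm_apply_orbitOperator_sub_le U f r (w i) x).trans ?_
    gcongr

/-- The vector is `A f` for a weak limit `A` of the orbit operators along an ultrafilter. The `ℓ¹`
bound makes `A` Hilbert–Schmidt, hence compact, while weights that are almost invariant under
translation make `A` almost commute with the representation. -/
theorem exists_isAlmostPeriodicOn_inner_ne_zero {l : Filter ι} {S : Set G} {D c : ℝ}
    (hD : ∀ i, l1Norm (w i) ≤ D)
    (hw : ∀ ε > 0, ∃ (F : Finset G) (S' : Set G), S ⊆ F + S' ∧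
      ∀ r ∈ S', ∀ᶠ i in l, l1Norm ((w i).mapDomain (r + ·) - w i) ≤ ε)
    (hc : 0 < c) (hf : ∃ᶠ i in l, c ≤ (w i).sum fun p t => t * ‖inner ℂ (U p f) f‖ ^ 2) :
    ∃ h : H, IsAlmostPeriodicOn U S h ∧ inner ℂ h f ≠ 0 := by
  have := frequently_iff_neBot.1 hf
  set 𝒰 := Ultrafilter.of (l ⊓ 𝓟 {i | c ≤ (w i).sum fun p t => t * ‖inner ℂ (U p f) f‖ ^ 2})
  have h𝒰l : (𝒰 : Filter ι) ≤ l := (Ultrafilter.of_le _).trans inf_le_left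
  have h𝒰c : ∀ᶠ i in 𝒰, c ≤ (w i).sum fun p t => t * ‖inner ℂ (U p f) f‖ ^ 2 :=
    le_principal_iff.1 ((Ultrafilter.of_le _).trans inf_le_right)
  obtain ⟨A, hA⟩ := exists_clm_tendsto_inner_of_norm_le (𝕜 := ℂ) 𝒰
    fun i => (norm_orbitOperator_le U f (w i)).trans
      (mul_le_mul_of_nonneg_left (hD i) (by positivity))
  refine ⟨A f, ?_, fun h0 => ?_⟩
  · refine isAlmostPeriodicOn_of_isCompactOperator
      (isCompactOperator_of_tendsto_inner_orbitOperator hD hA) fun ε hε => ?_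
    obtain ⟨F, S', hS, hr⟩ := hw (ε / (‖f‖ ^ 2 * ‖f‖ + 1)) (by positivity)
    refine ⟨F, S', hS, fun r hrS => ?_⟩
    refine (norm_apply_sub_le_of_tendsto_inner_orbitOperator
      ((hr r hrS).filter_mono h𝒰l) hA f).trans_lt ?_
    rw [mul_right_comm, mul_div_assoc', div_lt_iff₀ (by positivity), mul_comm]
    gcongr
    exact lt_add_one _
  · have tendsto_re := (Complex.continuous_re.tendsto _).comp (hA f f)
    simp only [h0, Complex.zero_re, Function.comp_def, inner_orbitOperator_self,
      Complex.ofReal_re] at tendsto_re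
    exact hc.not_ge (ge_of_tendsto tendsto_re h𝒰c)

end OrbitOperator

section Strip

open scoped Pointwise

/-- The vertical distance, with sign, from the line of slope `β` through the origin. -/
def offset (β : ℝ) : ℤ × ℤ →+ ℝ where
  toFun p := p.2 - β * p.1
  map_zero' := by simp
  map_add' p q := by simp only [Prod.fst_add, Prod.snd_add, Int.cast_add]; ring

theorem offset_apply (β : ℝ) (p : ℤ × ℤ) : offset β p = p.2 - β * p.1 := rfl

theorem mem_strip_iff {β b : ℝ} {p : ℤ × ℤ} : p ∈ strip β b ↔ |offset β p| ≤ b / 2 := by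
  rw [strip, Set.mem_ofPred_eq, abs_le, offset_apply]
  constructor <;> rintro ⟨h₁, h₂⟩ <;> constructor <;> linarith

theorem mem_stripTrunc_iff {β b : ℝ} {k : ℕ} {p : ℤ × ℤ} :
    p ∈ stripTrunc β b k ↔ p ∈ strip β b ∧ 0 ≤ p.1 ∧ p.1 < k := by
  simp [stripTrunc]

theorem exists_finset_strip_subset_add (β b' : ℝ) {b : ℝ} (hb : 0 < b) :
    ∃ F : Finset (ℤ × ℤ), strip β b' ⊆ F + strip β b := by
  have totallyBounded_offset : TotallyBounded (offset β '' strip β b') := by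
    refine (totallyBounded_Icc (-(b' / 2)) (b' / 2)).subset ?_
    rintro _ ⟨p, hp, rfl⟩
    exact abs_le.1 (mem_strip_iff.1 hp)
  obtain ⟨F, -, hF, hcov⟩ := Set.exists_subset_image_finite_and.1
    (totallyBounded_offset.exists_subset (Metric.dist_mem_uniformity (half_pos hb)))
  lift F to Finset (ℤ × ℤ) using hF
  refine ⟨F, fun p hp => ?_⟩
  obtain ⟨_, ⟨q, hq, rfl⟩, hpq⟩ := Set.mem_iUnion₂.1 (hcov ⟨p, hp, rfl⟩)
  refine Set.mem_add.2 ⟨q, hq, p - q, mem_strip_iff.2 ?_, add_sub_cancel q p⟩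
  rw [map_sub, ← Real.dist_eq]
  exact hpq.le

theorem mk_round_mem_strip_one (β : ℝ) (m : ℤ) : (m, round (β * m)) ∈ strip β 1 := by
  rw [mem_strip_iff, offset_apply, abs_sub_comm]
  exact abs_sub_round _

theorem exists_le_card_stripTrunc (β : ℝ) {b : ℝ} (hb : 0 < b) :
    ∃ δ : ℝ, 0 < δ ∧ ∀ᶠ k : ℕ in atTop, δ * k ≤ (stripTrunc β b k).card := by
  obtain ⟨F, hF⟩ := exists_finset_strip_subset_add β 1 hb
  obtain ⟨M, hM⟩ := (F.image fun q => q.1.natAbs).exists_le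
  simp only [Finset.forall_mem_image] at hM
  refine ⟨(2 * (F.card + 1) : ℝ)⁻¹, by positivity, ?_⟩
  filter_upwards [eventually_ge_atTop (4 * M)] with k hk
  have Ico_subset : Finset.Ico (M : ℤ) (k - M) ⊆
      (F ×ˢ stripTrunc β b k).image fun qp => qp.1.1 + qp.2.1 := by
    intro m hm
    rw [Finset.mem_Ico] at hm
    obtain ⟨q, hq, p, hp, hqp⟩ := Set.mem_add.1 (hF (mk_round_mem_strip_one β m))
    have hqp₁ : q.1 + p.1 = m := congrArg Prod.fst hqp
    have hqM := hM hq
    refine Finset.mem_image.2 ⟨(q, p), Finset.mem_product.2 ⟨hq, ?_⟩, hqp₁⟩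
    exact mem_stripTrunc_iff.2 ⟨hp, by dsimp only; omega, by dsimp only; omega⟩
  have card_Ico_le : k - 2 * M ≤ F.card * (stripTrunc β b k).card := by
    refine le_trans ?_ ((Finset.card_le_card Ico_subset).trans Finset.card_image_le |>.trans_eq
      (Finset.card_product _ _))
    rw [Int.card_Ico]
    omega
  have le_card : (k : ℝ) ≤ 2 * (F.card * (stripTrunc β b k).card) := by
    exact_mod_cast (by omega : k ≤ 2 * (F.card * (stripTrunc β b k).card))
  rw [inv_mul_le_iff₀ (by positivity)]
  nlinarith [Nat.cast_nonneg (α := ℝ) (stripTrunc β b k).card]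

/-- The lattice points at vertical distance at most `R` from the line of slope `β` through the
origin in the columns `-M, …, M`. -/
noncomputable def stripBox (β R : ℝ) (M : ℕ) : Finset (ℤ × ℤ) :=
  (Finset.Icc (-M : ℤ) M).biUnion fun m => (Finset.Icc ⌈β * m - R⌉ ⌊β * m + R⌋).image (m, ·)

theorem mem_stripBox_iff {β R : ℝ} {M : ℕ} {p : ℤ × ℤ} :
    p ∈ stripBox β R M ↔ |offset β p| ≤ R ∧ |p.1| ≤ M := by
  obtain ⟨m, n⟩ := p
  simp only [stripBox, Finset.mem_biUnion, Finset.mem_image, Finset.mem_Icc, Int.ceil_le,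
    Int.le_floor, Prod.mk.injEq, offset_apply, abs_le]
  constructor
  · rintro ⟨_, hm, _, hn, rfl, rfl⟩
    exact ⟨⟨by linarith, by linarith⟩, hm⟩
  · rintro ⟨hn, hm⟩
    exact ⟨m, hm, n, ⟨by linarith, by linarith⟩, rfl, rfl⟩

theorem card_stripBox_le (β : ℝ) {R : ℝ} (hR : 0 ≤ R) (M : ℕ) :
    ((stripBox β R M).card : ℝ) ≤ (2 * M + 1) * (2 * R + 1) := by
  have card_column_le (m : ℤ) :
      ((Finset.Icc ⌈β * m - R⌉ ⌊β * m + R⌋).image (m, ·)).card ≤ ⌊2 * R⌋₊ + 1 := by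
    refine Finset.card_image_le.trans ?_
    rw [Int.card_Icc, Int.toNat_le]
    have := Int.floor_le (β * m + R)
    have := Int.le_ceil (β * m - R)
    have : ⌊β * m + R⌋ - ⌈β * m - R⌉ ≤ ⌊2 * R⌋ := Int.le_floor.2 (by push_cast; linarith)
    rw [← Int.natCast_floor_eq_floor (by positivity : 0 ≤ 2 * R)] at this
    push_cast
    linarith
  have card_le : (stripBox β R M).card ≤ (2 * M + 1) * (⌊2 * R⌋₊ + 1) := by
    refine (Finset.card_biUnion_le_card_mul _ _ _ fun m _ => card_column_le m).trans_eq ?_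
    rw [Int.card_Icc]
    congr 1
    omega
  calc ((stripBox β R M).card : ℝ) ≤ (2 * M + 1) * (⌊2 * R⌋₊ + 1) := mod_cast card_le
    _ ≤ (2 * M + 1) * (2 * R + 1) := by gcongr; exact Nat.floor_le (by positivity)

end Strip

section StripWeight

open scoped Pointwise

/-- The piecewise linear bump function of height and radius `c` around the origin. -/
noncomputable def tent (c s : ℝ) : ℝ :=
  max 0 (c - |s|)

theorem tent_nonneg (c s : ℝ) : 0 ≤ tent c s := le_max_left _ _

theorem tent_le {c : ℝ} (hc : 0 ≤ c) (s : ℝ) : tent c s ≤ c :=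
  max_le hc (sub_le_self _ (abs_nonneg s))

theorem tent_eq_zero {c s : ℝ} (h : c ≤ |s|) : tent c s = 0 := max_eq_left (sub_nonpos.2 h)

theorem abs_tent_sub_tent_le (c s t : ℝ) : |tent c s - tent c t| ≤ |s - t| := by
  simp only [tent, max_comm (0 : ℝ)]
  refine (abs_max_sub_max_le_abs _ _ _).trans ?_
  rw [sub_sub_sub_cancel_left, abs_sub_comm s t]
  exact abs_abs_sub_abs_le _ _

/-- A product of bump functions across and along the strip of slope `β`, normalised so that its
`ℓ¹` norm stays bounded as `k → ∞`. Since both factors are Lipschitz, it is almost invariant in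
`ℓ¹` under translation by lattice points of small offset. -/
noncomputable def stripWeight (β b : ℝ) (k : ℕ) : ℤ × ℤ →₀ ℝ :=
  Finsupp.onFinset (stripBox β b (2 * k))
    (fun p => tent b (offset β p) * tent (2 * k) p.1 / k ^ 2) fun p hp => by
      by_contra hbox
      rw [mem_stripBox_iff, not_and_or, not_le, not_le] at hbox
      refine hp ?_
      rcases hbox with h | h
      · rw [tent_eq_zero h.le, zero_mul, zero_div]
      · rw [tent_eq_zero (s := p.1) (by exact_mod_cast h.le), mul_zero, zero_div]

theorem stripWeight_apply (β b : ℝ) (k : ℕ) (p : ℤ × ℤ) :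
    stripWeight β b k p = tent b (offset β p) * tent (2 * k) p.1 / k ^ 2 := rfl

theorem stripWeight_nonneg (β b : ℝ) (k : ℕ) (p : ℤ × ℤ) : 0 ≤ stripWeight β b k p :=
  div_nonneg (mul_nonneg (tent_nonneg _ _) (tent_nonneg _ _)) (by positivity)

theorem mapDomain_add_left_apply {G M : Type*} [AddGroup G] [AddCommMonoid M] (r p : G)
    (w : G →₀ M) : w.mapDomain (r + ·) p = w (-r + p) := by
  conv_lhs => rw [← add_neg_cancel_left r p]
  exact Finsupp.mapDomain_apply (add_right_injective r) w _

theorem support_stripWeight_subset (β b : ℝ) (k : ℕ) :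
    (stripWeight β b k).support ⊆ stripBox β b (2 * k) :=
  Finsupp.support_onFinset_subset

theorem l1Norm_stripWeight_le (β : ℝ) {b : ℝ} (hb : 0 ≤ b) (k : ℕ) :
    l1Norm (stripWeight β b k) ≤ 10 * b * (2 * b + 1) := by
  rcases k.eq_zero_or_pos with rfl | hk
  · have stripWeight_zero : stripWeight β b 0 = 0 := by ext p; simp [stripWeight_apply]
    simp only [stripWeight_zero, l1Norm, Finsupp.sum_zero_index]
    positivity
  have hk1 : (1 : ℝ) ≤ k := by exact_mod_cast hk
  have abs_le (p : ℤ × ℤ) : |stripWeight β b k p| ≤ b * (2 * k) / k ^ 2 := by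
    rw [abs_of_nonneg (stripWeight_nonneg β b k p), stripWeight_apply]
    gcongr
    · exact tent_nonneg _ _
    · exact tent_le hb _
    · exact tent_le (by positivity) _
  calc l1Norm (stripWeight β b k)
    _ ≤ (stripBox β b (2 * k)).card * (b * (2 * k) / k ^ 2) :=
        l1Norm_le_card_mul (support_stripWeight_subset β b k) abs_le
    _ ≤ (5 * k) * (2 * b + 1) * (b * (2 * k) / k ^ 2) := by
        gcongr
        refine (card_stripBox_le β hb _).trans ?_
        gcongr
        push_cast
        linarith
    _ = 10 * b * (2 * b + 1) := by field_simp; ring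

theorem abs_mapDomain_stripWeight_sub_le (β : ℝ) {b : ℝ} (hb : 0 ≤ b) (k : ℕ) (r p : ℤ × ℤ) :
    |((stripWeight β b k).mapDomain (r + ·) - stripWeight β b k) p| ≤
      (2 * k * |offset β r| + b * |(r.1 : ℝ)|) / k ^ 2 := by
  set q := -r + p with hq
  have offset_sub : offset β q - offset β p = -offset β r := by rw [hq, map_add, map_neg]; ring
  have fst_sub : (q.1 : ℝ) - p.1 = -r.1 := by simp [hq]
  rw [Finsupp.sub_apply, mapDomain_add_left_apply, ← hq, stripWeight_apply, stripWeight_apply,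
    ← sub_div, abs_div, abs_of_nonneg (a := (k : ℝ) ^ 2) (by positivity)]
  gcongr
  calc |tent b (offset β q) * tent (2 * k) q.1 - tent b (offset β p) * tent (2 * k) p.1|
    _ = |tent (2 * k) q.1 * (tent b (offset β q) - tent b (offset β p))
          + tent b (offset β p) * (tent (2 * k) q.1 - tent (2 * k) p.1)| := by ring_nf
    _ ≤ tent (2 * k) q.1 * |offset β q - offset β p| + tent b (offset β p) * |(q.1 : ℝ) - p.1| := by
        refine (abs_add_le _ _).trans ?_
        rw [abs_mul, abs_mul, abs_of_nonneg (tent_nonneg _ _), abs_of_nonneg (tent_nonneg _ _)]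
        exact add_le_add
          (mul_le_mul_of_nonneg_left (abs_tent_sub_tent_le _ _ _) (tent_nonneg _ _))
          (mul_le_mul_of_nonneg_left (abs_tent_sub_tent_le _ _ _) (tent_nonneg _ _))
    _ ≤ 2 * k * |offset β r| + b * |(r.1 : ℝ)| := by
        rw [offset_sub, fst_sub, abs_neg, abs_neg]
        gcongr
        · exact tent_le (by positivity) _
        · exact tent_le hb _

theorem support_mapDomain_stripWeight_sub_subset {β b : ℝ} {k : ℕ} {r : ℤ × ℤ}
    (hr : |offset β r| ≤ b) (hrk : |r.1| ≤ k) :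
    ((stripWeight β b k).mapDomain (r + ·) - stripWeight β b k).support ⊆
      stripBox β (2 * b) (3 * k) := by
  have hb : 0 ≤ b := (abs_nonneg _).trans hr
  classical
  refine Finsupp.support_sub.trans (Finset.union_subset ?_ ?_)
  · refine Finsupp.mapDomain_support.trans (Finset.image_subset_iff.2 fun p hp => ?_)
    obtain ⟨hp₂, hp₁⟩ := mem_stripBox_iff.1 (support_stripWeight_subset β b k hp)
    rw [mem_stripBox_iff, map_add, Prod.fst_add]
    push_cast at hp₁ ⊢
    exact ⟨(abs_add_le _ _).trans (by linarith), (abs_add_le _ _).trans (by linarith)⟩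
  · refine fun p hp => ?_
    obtain ⟨hp₂, hp₁⟩ := mem_stripBox_iff.1 (support_stripWeight_subset β b k hp)
    push_cast at hp₁
    exact mem_stripBox_iff.2 ⟨by linarith, by push_cast; linarith⟩

theorem l1Norm_mapDomain_stripWeight_sub_le {β b : ℝ} {k : ℕ} {r : ℤ × ℤ}
    (hr : |offset β r| ≤ b) (hk : 0 < k) (hrk : |r.1| ≤ k) :
    l1Norm ((stripWeight β b k).mapDomain (r + ·) - stripWeight β b k) ≤
      7 * (4 * b + 1) * (2 * |offset β r| + b * |(r.1 : ℝ)| / k) := by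
  have hb : 0 ≤ b := (abs_nonneg _).trans hr
  have hk1 : (1 : ℝ) ≤ k := by exact_mod_cast hk
  calc l1Norm ((stripWeight β b k).mapDomain (r + ·) - stripWeight β b k)
    _ ≤ (stripBox β (2 * b) (3 * k)).card * ((2 * k * |offset β r| + b * |(r.1 : ℝ)|) / k ^ 2) :=
        l1Norm_le_card_mul (support_mapDomain_stripWeight_sub_subset hr hrk)
          (abs_mapDomain_stripWeight_sub_le β hb k r)
    _ ≤ (7 * k * (4 * b + 1)) * ((2 * k * |offset β r| + b * |(r.1 : ℝ)|) / k ^ 2) := by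
        gcongr
        refine (card_stripBox_le β (by positivity) _).trans ?_
        push_cast
        rw [← mul_assoc 2 2 b]
        gcongr
        · linarith
        · norm_num
    _ = 7 * (4 * b + 1) * (2 * |offset β r| + b * |(r.1 : ℝ)| / k) := by field_simp

theorem eventually_l1Norm_mapDomain_stripWeight_sub_le {β b ε : ℝ} {r : ℤ × ℤ}
    (hr : |offset β r| ≤ b) (hrε : 7 * (4 * b + 1) * (2 * |offset β r|) < ε) :
    ∀ᶠ k in atTop, l1Norm ((stripWeight β b k).mapDomain (r + ·) - stripWeight β b k) ≤ ε := by
  have tendsto_bound : Tendsto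
      (fun k : ℕ => 7 * (4 * b + 1) * (2 * |offset β r| + b * |(r.1 : ℝ)| / k)) atTop
      (𝓝 (7 * (4 * b + 1) * (2 * |offset β r|))) := by
    simpa only [add_zero] using
      ((tendsto_const_div_atTop_nhds_zero_nat _).const_add (2 * |offset β r|)).const_mul _
  filter_upwards [tendsto_bound.eventually_lt_const hrε, eventually_gt_atTop 0,
    eventually_ge_atTop r.1.natAbs] with k hk hk0 hrk
  exact (l1Norm_mapDomain_stripWeight_sub_le hr hk0 (by rw [Int.abs_eq_natAbs]; omega)).trans hk.le

theorem exists_strip_subset_add_forall_eventually_l1Norm_le (β b₀ : ℝ) {b : ℝ} (hb : 0 < b)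
    {ε : ℝ} (hε : 0 < ε) :
    ∃ (F : Finset (ℤ × ℤ)) (S : Set (ℤ × ℤ)), strip β b₀ ⊆ F + S ∧ ∀ r ∈ S, ∀ᶠ k in atTop,
      l1Norm ((stripWeight β b k).mapDomain (r + ·) - stripWeight β b k) ≤ ε := by
  set η := min b (ε / (8 * (4 * b + 1)))
  have hη0 : 0 < η := by positivity
  obtain ⟨F, hF⟩ := exists_finset_strip_subset_add β b₀ hη0
  refine ⟨F, strip β η, hF, fun r hr => ?_⟩
  rw [mem_strip_iff] at hr
  refine eventually_l1Norm_mapDomain_stripWeight_sub_le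
    (by linarith [min_le_left b (ε / (8 * (4 * b + 1)))]) ?_
  calc 7 * (4 * b + 1) * (2 * |offset β r|) ≤ 7 * (4 * b + 1) * (ε / (8 * (4 * b + 1))) := by
        gcongr
        linarith [min_le_right b (ε / (8 * (4 * b + 1)))]
    _ = 7 / 8 * ε := by field_simp
    _ < ε := by linarith

theorem half_div_mul_sum_stripTrunc_le {β b : ℝ} (hb : 0 ≤ b) {k : ℕ} {a : ℤ × ℤ → ℝ}
    (ha : ∀ p, 0 ≤ a p) :
    b / 2 / k * ∑ p ∈ stripTrunc β b k, a p ≤ (stripWeight β b k).sum fun p t => t * a p := by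
  have stripTrunc_subset : stripTrunc β b k ⊆ stripBox β b (2 * k) := fun p hp => by
    obtain ⟨hp, hp0, hpk⟩ := mem_stripTrunc_iff.1 hp
    rw [mem_stripBox_iff, abs_of_nonneg hp0]
    exact ⟨(mem_strip_iff.1 hp).trans (half_le_self hb), by omega⟩
  have le_weight (p) (hp : p ∈ stripTrunc β b k) : b / 2 / k ≤ stripWeight β b k p := by
    obtain ⟨hp, hp0, hpk⟩ := mem_stripTrunc_iff.1 hp
    have hk : (0 : ℝ) < k := by exact_mod_cast hp0.trans_lt hpk
    have half_le_tent : b / 2 ≤ tent b (offset β p) :=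
      le_max_of_le_right (by linarith [mem_strip_iff.1 hp])
    have le_tent : (k : ℝ) ≤ tent (2 * k) p.1 := by
      refine le_max_of_le_right ?_
      rw [abs_of_nonneg (by exact_mod_cast hp0)]
      linarith [(by exact_mod_cast hpk.le : (p.1 : ℝ) ≤ k)]
    calc b / 2 / k = b / 2 * k / k ^ 2 := by field_simp
      _ ≤ stripWeight β b k p := by
          rw [stripWeight_apply]
          gcongr
          exact tent_nonneg _ _
  rw [Finsupp.sum_of_support_subset _ (support_stripWeight_subset β b k) _ (by simp),
    Finset.mul_sum]
  calc ∑ p ∈ stripTrunc β b k, b / 2 / k * a p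
    _ ≤ ∑ p ∈ stripTrunc β b k, stripWeight β b k p * a p := by
        gcongr with p hp
        · exact ha p
        · exact le_weight p hp
    _ ≤ ∑ p ∈ stripBox β b (2 * k), stripWeight β b k p * a p :=
        Finset.sum_le_sum_of_subset_of_nonneg stripTrunc_subset fun p _ _ =>
          mul_nonneg (stripWeight_nonneg β b k p) (ha p)

end StripWeight

section StripAverage

variable {β b : ℝ} {a a' : ℤ × ℤ → ℝ}

theorem stripAverage_nonneg (ha : ∀ p, 0 ≤ a p) (k : ℕ) : 0 ≤ stripAverage β b a k :=
  mul_nonneg (by positivity) (Finset.sum_nonneg fun p _ => ha p)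

theorem sq_stripAverage_mul_card_le (a : ℤ × ℤ → ℝ) (k : ℕ) :
    stripAverage β b a k ^ 2 * (stripTrunc β b k).card ≤ ∑ p ∈ stripTrunc β b k, a p ^ 2 := by
  rcases (stripTrunc β b k).card.eq_zero_or_pos with h0 | hpos
  · simp only [h0, Nat.cast_zero, mul_zero]
    positivity
  · calc stripAverage β b a k ^ 2 * (stripTrunc β b k).card
      _ = (∑ p ∈ stripTrunc β b k, a p) ^ 2 / (stripTrunc β b k).card := by
          rw [stripAverage]
          field_simp
      _ ≤ ∑ p ∈ stripTrunc β b k, a p ^ 2 := by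
          rw [div_le_iff₀' (by exact_mod_cast hpos)]
          exact sq_sum_le_card_mul_sum_sq

theorem exists_frequently_le_sum_stripWeight (hb : 0 < b) (ha : ∀ p, 0 ≤ a p)
    (h : ¬ Tendsto (stripAverage β b a) atTop (𝓝 0)) :
    ∃ c > 0, ∃ᶠ k in atTop, c ≤ (stripWeight β b k).sum fun p t => t * a p ^ 2 := by
  obtain ⟨ε, hε, hfreq⟩ : ∃ ε > 0, ∃ᶠ k in atTop, ε ≤ stripAverage β b a k := by
    contrapose! h
    refine tendsto_order.2 ⟨fun c hc => .of_forall fun k => hc.trans_le (stripAverage_nonneg ha k),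
      fun c hc => ?_⟩
    simpa only [not_frequently, not_le] using h c hc
  obtain ⟨δ, hδ, hcard⟩ := exists_le_card_stripTrunc β hb
  refine ⟨b / 2 * (ε ^ 2 * δ), by positivity, ?_⟩
  refine (hfreq.and_eventually (hcard.and (eventually_gt_atTop 0))).mono ?_
  rintro k ⟨hk, hkδ, hk0⟩
  have : (0 : ℝ) < k := by exact_mod_cast hk0
  calc b / 2 * (ε ^ 2 * δ) = b / 2 / k * (ε ^ 2 * (δ * k)) := by field_simp
    _ ≤ b / 2 / k * (stripAverage β b a k ^ 2 * (stripTrunc β b k).card) := by gcongr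
    _ ≤ b / 2 / k * ∑ p ∈ stripTrunc β b k, a p ^ 2 := by
        gcongr
        exact sq_stripAverage_mul_card_le a k
    _ ≤ (stripWeight β b k).sum fun p t => t * a p ^ 2 :=
        half_div_mul_sum_stripTrunc_le hb.le fun p => sq_nonneg (a p)

theorem stripAverage_mono {k : ℕ} (h : ∀ p ∈ stripTrunc β b k, a p ≤ a' p) :
    stripAverage β b a k ≤ stripAverage β b a' k :=
  mul_le_mul_of_nonneg_left (Finset.sum_le_sum h) (by positivity)

theorem stripAverage_sum {ι : Type*} (s : Finset ι) (a : ι → ℤ × ℤ → ℝ) (k : ℕ) :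
    stripAverage β b (fun p => ∑ i ∈ s, a i p) k = ∑ i ∈ s, stripAverage β b (a i) k := by
  simp only [stripAverage]
  rw [Finset.sum_comm, Finset.mul_sum]

theorem tendsto_stripAverage_sum {ι : Type*} {s : Finset ι} {a : ι → ℤ × ℤ → ℝ}
    (h : ∀ i ∈ s, Tendsto (stripAverage β b (a i)) atTop (𝓝 0)) :
    Tendsto (stripAverage β b fun p => ∑ i ∈ s, a i p) atTop (𝓝 0) := by
  simpa only [← stripAverage_sum, Finset.sum_const_zero] using tendsto_finsetSum s h

theorem stripTrunc_nonempty (hb : 0 ≤ b) {k : ℕ} (hk : 0 < k) : (stripTrunc β b k).Nonempty := by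
  refine ⟨0, mem_stripTrunc_iff.2 ⟨mem_strip_iff.2 ?_, le_rfl, by simpa using hk⟩⟩
  rw [map_zero, abs_zero]
  positivity

theorem stripAverage_const (hb : 0 ≤ b) {k : ℕ} (hk : 0 < k) (c : ℝ) :
    stripAverage β b (fun _ => c) k = c := by
  have card_ne_zero : ((stripTrunc β b k).card : ℝ) ≠ 0 := by
    exact_mod_cast (stripTrunc_nonempty hb hk).card_ne_zero
  rw [stripAverage, Finset.sum_const, nsmul_eq_mul, one_div, inv_mul_cancel_left₀ card_ne_zero]

end StripAverage

section Correlations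

variable {H : Type*} [NormedAddCommGroup H] [InnerProductSpace ℂ H] {β b₀ b : ℝ}

theorem tendsto_stripAverage_norm_inner_self [CompleteSpace H] {U : AddChar (ℤ × ℤ) (H →ₗᵢ[ℂ] H)}
    (hb : 0 < b) {f : H} (hf : ∀ h, IsAlmostPeriodicOn U (strip β b₀) h → inner ℂ h f = 0) :
    Tendsto (stripAverage β b fun p => ‖inner ℂ (U p f) f‖) atTop (𝓝 0) := by
  by_contra hlim
  obtain ⟨c, hc, hfreq⟩ := exists_frequently_le_sum_stripWeight hb (fun _ => norm_nonneg _) hlim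
  obtain ⟨h, hh, hne⟩ := exists_isAlmostPeriodicOn_inner_ne_zero
    (l1Norm_stripWeight_le β hb.le)
    (fun ε hε => exists_strip_subset_add_forall_eventually_l1Norm_le β b₀ hb hε) hc hfreq
  exact hne (hf h hh)

theorem IsAlmostPeriodicOn.eq_zero_of_forall_tendsto {U : AddChar (ℤ × ℤ) (H →ₗᵢ[ℂ] H)}
    (hb : 0 ≤ b) {f : H} (hf : IsAlmostPeriodicOn U (strip β b) f)
    (h : ∀ g, Tendsto (stripAverage β b fun p => ‖inner ℂ g (U p f)‖) atTop (𝓝 0)) : f = 0 := by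
  obtain ⟨t, ht⟩ := hf.exists_finset_le_sum_norm_inner
  have norm_sq_le : ‖f‖ ^ 2 / 2 ≤ 0 := by
    refine ge_of_tendsto (tendsto_stripAverage_sum fun y (_ : y ∈ t) => h y) ?_
    filter_upwards [eventually_gt_atTop 0] with k hk
    rw [← stripAverage_const hb hk (β := β) (‖f‖ ^ 2 / 2)]
    exact stripAverage_mono fun p hp => ht p (mem_stripTrunc_iff.1 hp).1
  have : ‖f‖ ^ 2 = 0 := le_antisymm (by linarith) (sq_nonneg _)
  simpa using this

theorem tendsto_stripAverage_norm_inner_of_forall_self {A : ℤ × ℤ → H →ₗ[ℂ] H}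
    (h : ∀ f, Tendsto (stripAverage β b fun p => ‖inner ℂ f (A p f)‖) atTop (𝓝 0)) (f g : H) :
    Tendsto (stripAverage β b fun p => ‖inner ℂ g (A p f)‖) atTop (𝓝 0) := by
  let w : Fin 4 → H := ![f + g, f - g, f + Complex.I • g, f - Complex.I • g]
  refine squeeze_zero (stripAverage_nonneg fun _ => norm_nonneg _)
    (fun k => stripAverage_mono fun p _ => ?_)
    (tendsto_stripAverage_sum (s := Finset.univ) fun i _ => h (w i))
  simp only [norm_inner_symm _ (A p _)]
  rw [inner_map_polarization', norm_div, Fin.sum_univ_four]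
  refine (div_le_self (norm_nonneg _) (by norm_num)).trans ?_
  refine (norm_add_le_of_le (norm_sub_le_of_le (norm_sub_le _ _) le_rfl) le_rfl).trans_eq ?_
  simp only [norm_mul, Complex.norm_I, one_mul]
  rfl

end Correlations

section Truncation

variable {X E : Type*} [MeasurableSpace X] {μ : Measure X} [NormedAddCommGroup E] {p : ℝ≥0∞}

theorem tendsto_Lp_of_tendsto_ae_of_norm_sub_le [IsFiniteMeasure μ] [Fact (1 ≤ p)] (hp : p ≠ ∞)
    {u : ℕ → Lp E p μ} {g : Lp E p μ} {C : ℝ} (hC : ∀ n, ∀ᵐ x ∂μ, ‖u n x - g x‖ ≤ C)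
    (h : ∀ᵐ x ∂μ, Tendsto (fun n => u n x) atTop (𝓝 (g x))) : Tendsto u atTop (𝓝 g) := by
  have p_ne_zero : p ≠ 0 := (one_pos.trans_le Fact.out).ne'
  have p_pos : 0 < p.toReal := ENNReal.toReal_pos p_ne_zero hp
  have tendsto_lintegral :
      Tendsto (fun n => ∫⁻ x, ‖u n x - g x‖ₑ ^ p.toReal ∂μ) atTop (𝓝 0) := by
    rw [← lintegral_zero (μ := μ)]
    refine tendsto_lintegral_of_dominated_convergence' (fun _ => ENNReal.ofReal C ^ p.toReal)
      (fun n => ((Lp.aestronglyMeasurable (u n)).sub (Lp.aestronglyMeasurable g)).enorm.pow_const _)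
      (fun n => ?_) (by simp [lintegral_const, ENNReal.mul_eq_top, p_pos.le]) ?_
    · filter_upwards [hC n] with x hx
      rw [← ofReal_norm]
      gcongr
    · filter_upwards [h] with x hx
      simpa [ENNReal.zero_rpow_of_pos p_pos] using
        (tendsto_sub_nhds_zero_iff.2 hx).enorm.ennrpow_const p.toReal
  rw [Lp.tendsto_Lp_iff_tendsto_eLpNorm']
  simp only [eLpNorm_eq_lintegral_rpow_enorm_toReal p_ne_zero hp, Pi.sub_apply]
  simpa [p_pos] using tendsto_lintegral.ennrpow_const (1 / p.toReal)

/-- Lipschitz functions increasing to the indicator function of an open set `V`, which must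
not be the whole space: the distance to the empty set is `0` by convention. -/
noncomputable def indicatorApprox (V : Set E) (n : ℕ) (z : E) : ℂ :=
  (min 1 (n * Metric.infDist z Vᶜ) : ℝ)

theorem indicatorApprox_of_notMem {V : Set E} {z : E} (hz : z ∉ V) (n : ℕ) :
    indicatorApprox V n z = 0 := by
  simp [indicatorApprox, Metric.infDist_zero_of_mem (Set.mem_compl hz)]

theorem lipschitzWith_indicatorApprox (V : Set E) (n : ℕ) :
    LipschitzWith n (indicatorApprox V n) := by
  have lipschitzWith_mul : LipschitzWith n fun z => (n : ℝ) * Metric.infDist z Vᶜ := by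
    simpa using! (lipschitzWith_smul (n : ℝ)).comp (Metric.lipschitz_infDist_pt Vᶜ)
  simpa using! Complex.isometry_ofReal.lipschitz.comp (lipschitzWith_mul.const_min 1)

theorem norm_indicatorApprox_sub_indicator_le (V : Set E) (n : ℕ) (z : E) :
    ‖indicatorApprox V n z - V.indicator (fun _ => (1 : ℂ)) z‖ ≤ 1 := by
  by_cases hz : z ∈ V
  · have nonneg : 0 ≤ min 1 (n * Metric.infDist z Vᶜ) :=
      le_min zero_le_one (mul_nonneg n.cast_nonneg Metric.infDist_nonneg)
    rw [Set.indicator_of_mem hz, indicatorApprox, ← Complex.ofReal_one, ← Complex.ofReal_sub,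
      Complex.norm_real, Real.norm_eq_abs, abs_le]
    constructor <;> linarith [min_le_left 1 (n * Metric.infDist z Vᶜ)]
  · simp [Set.indicator_of_notMem hz, indicatorApprox_of_notMem hz]

theorem tendsto_indicatorApprox {V : Set E} (hV : IsOpen V) (hV0 : (0 : E) ∉ V) (z : E) :
    Tendsto (fun n => indicatorApprox V n z) atTop (𝓝 (V.indicator (fun _ => (1 : ℂ)) z)) := by
  by_cases hz : z ∈ V
  · have infDist_pos : 0 < Metric.infDist z Vᶜ :=
      (hV.isClosed_compl.notMem_iff_infDist_pos ⟨0, hV0⟩).1 (not_not_intro hz)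
    rw [Set.indicator_of_mem hz]
    refine tendsto_const_nhds.congr' ?_
    filter_upwards [(tendsto_natCast_atTop_atTop.atTop_mul_const infDist_pos).eventually_ge_atTop 1]
      with n hn
    rw [indicatorApprox, min_eq_left hn, Complex.ofReal_one]
  · simp only [Set.indicator_of_notMem hz, indicatorApprox_of_notMem hz, tendsto_const_nhds]

theorem measurableSet_preimage_coeFn (f : Lp E p μ) {V : Set E} (hV : IsOpen V) :
    MeasurableSet (f ⁻¹' V) := by
  borelize E
  exact hV.measurableSet.preimage (Lp.stronglyMeasurable f).measurable

theorem tendsto_indicatorApprox_compLp [IsFiniteMeasure μ] [Fact (1 ≤ p)] (hp : p ≠ ∞)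
    (f : Lp E p μ) {V : Set E} (hV : IsOpen V) (hV0 : (0 : E) ∉ V) :
    Tendsto (fun n =>
        (lipschitzWith_indicatorApprox V n).compLp (indicatorApprox_of_notMem hV0 n) f) atTop
      (𝓝 (indicatorConstLp p (measurableSet_preimage_coeFn f hV) (measure_ne_top μ _) 1)) := by
  have coeFn_compLp (n : ℕ) := (lipschitzWith_indicatorApprox V n).coeFn_compLp
    (indicatorApprox_of_notMem hV0 n) f
  have coeFn_indicator := indicatorConstLp_coeFn (p := p)
    (hs := measurableSet_preimage_coeFn f hV) (hμs := measure_ne_top μ _) (c := (1 : ℂ))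
  refine tendsto_Lp_of_tendsto_ae_of_norm_sub_le hp (C := 1) (fun n => ?_) ?_
  · filter_upwards [coeFn_compLp n, coeFn_indicator] with x hx hind
    rw [hx, hind]
    exact norm_indicatorApprox_sub_indicator_le V n (f x)
  · filter_upwards [ae_all_iff.2 coeFn_compLp, coeFn_indicator] with x hx hind
    simp only [hx, hind]
    exact tendsto_indicatorApprox hV hV0 (f x)

theorem smul_const_one [IsFiniteMeasure μ] (c : ℂ) :
    c • Lp.const p μ (1 : ℂ) = Lp.const p μ c := by
  have smul_one := (Lp.constₗ (E := ℂ) p μ ℂ).map_smul c 1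
  rw [smul_eq_mul, mul_one] at smul_one
  exact smul_one.symm

end Truncation

section Koopman

variable {X : Type*} [TopologicalSpace X] [MeasurableSpace X] [BorelSpace X]
  {T : ZTwoAction X} {μ : Measure X} {hμ : IsInvariant T μ} {β b : ℝ}

/-- The Koopman representation of `ℤ²` on `L²(X, μ)`. -/
noncomputable def koopmanRep (hμ : IsInvariant T μ) :
    AddChar (ℤ × ℤ) (Lp ℂ 2 μ →ₗᵢ[ℂ] Lp ℂ 2 μ) where
  toFun := koopman hμ
  map_zero_eq_one' := by
    have at_zero : ⇑(T.at 0) = id := by ext x; simp [ZTwoAction.at]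
    ext1 f
    simp only [koopman, at_zero]
    exact Lp.compMeasurePreserving_id_apply f
  map_add_eq_mul' p q := by
    have at_add : ⇑(T.at (p + q)) = T.at q ∘ T.at p := by
      rw [add_comm]; ext x; simp [ZTwoAction.at, ofAdd_add]
    ext1 f
    simp only [koopman, at_add]
    exact Lp.compMeasurePreserving_comp_apply f _ _

theorem coeFn_koopman (p : ℤ × ℤ) (f : Lp ℂ 2 μ) : koopman hμ p f =ᵐ[μ] f ∘ T.at p :=
  Lp.coeFn_compMeasurePreserving f (hμ.measurePreserving p)

theorem koopman_const [IsFiniteMeasure μ] (p : ℤ × ℤ) (c : ℂ) :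
    koopman hμ p (Lp.const 2 μ c) = Lp.const 2 μ c := rfl

theorem koopman_compLp {g : ℂ → ℂ} {K : NNReal} (hg : LipschitzWith K g) (g0 : g 0 = 0)
    (p : ℤ × ℤ) (f : Lp ℂ 2 μ) :
    koopman hμ p (hg.compLp g0 f) = hg.compLp g0 (koopman hμ p f) := by
  refine Lp.ext ((coeFn_koopman p _).trans ?_)
  filter_upwards [(hμ.measurePreserving p).quasiMeasurePreserving.ae_eq_comp
    (hg.coeFn_compLp g0 f), hg.coeFn_compLp g0 (koopman hμ p f), coeFn_koopman p f]
    with x hgf hgT hT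
  rw [hgf, hgT]
  exact congrArg g hT.symm

theorem mem_kroneckerAlgebra_iff [IsFiniteMeasure μ] {B : Set X} :
    B ∈ kroneckerAlgebra hμ β b ↔ ∃ hB : MeasurableSet B, IsAlmostPeriodicOn (koopmanRep hμ)
      (strip β b) (indicatorConstLp 2 hB (measure_ne_top μ B) (1 : ℂ)) :=
  exists_congr fun _ => ⟨fun h => h.totallyBounded.subset subset_closure,
    fun h => h.closure.isCompact_of_isClosed isClosed_closure⟩

theorem IsAlmostPeriodicOn.preimage_mem_kroneckerAlgebra [IsFiniteMeasure μ] {f : Lp ℂ 2 μ}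
    (hf : IsAlmostPeriodicOn (koopmanRep hμ) (strip β b) f) {V : Set ℂ} (hV : IsOpen V)
    (hV0 : 0 ∉ V) : f ⁻¹' V ∈ kroneckerAlgebra hμ β b :=
  mem_kroneckerAlgebra_iff.2 ⟨measurableSet_preimage_coeFn f hV, .of_tendsto
    (fun n => hf.map
      ((lipschitzWith_indicatorApprox V n).lipschitzWith_compLp _).uniformContinuous
      fun p _ => koopman_compLp (hμ := hμ) _ _ p f)
    (tendsto_indicatorApprox_compLp ENNReal.ofNat_ne_top f hV hV0)⟩

theorem IsDirWeakMixing.ae_mem_or_ae_notMem [IsFiniteMeasure μ] (h : IsDirWeakMixing hμ β b)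
    {f : Lp ℂ 2 μ} (hf : IsAlmostPeriodicOn (koopmanRep hμ) (strip β b) f) {V : Set ℂ}
    (hV : IsOpen V) (hV0 : 0 ∉ V) : (∀ᵐ x ∂μ, f x ∈ V) ∨ ∀ᵐ x ∂μ, f x ∉ V := by
  rcases h _ (hf.preimage_mem_kroneckerAlgebra hV hV0) with h_empty | h_univ
  · exact .inr (eventuallyEq_empty.1 h_empty)
  · exact .inl (eventuallyEq_univ.1 h_univ)

theorem IsDirWeakMixing.mem_span_const [IsFiniteMeasure μ] (h : IsDirWeakMixing hμ β b)
    {f : Lp ℂ 2 μ} (hf : IsAlmostPeriodicOn (koopmanRep hμ) (strip β b) f) :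
    f ∈ Submodule.span ℂ {Lp.const 2 μ (1 : ℂ)} := by
  -- Only functions vanishing at `0` act on `L²` by composition, so `V` is treated as `V \ {0}`,
  -- and the level set of `0` separately.
  have trivial_of_isOpen (V : Set ℂ) (hV : IsOpen V) :
      (∀ᵐ x ∂μ, f x ∈ V) ∨ ∀ᵐ x ∂μ, f x ∉ V := by
    rcases h.ae_mem_or_ae_notMem hf (hV.sdiff isClosed_singleton) (V := V \ {0}) (by simp)
      with h_mem | h_notMem
    · exact .inl (h_mem.mono fun x hx => hx.1)
    rcases h.ae_mem_or_ae_notMem hf (isOpen_compl_singleton (x := (0 : ℂ))) (by simp)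
      with h_ne | h_eq
    · refine .inr ?_
      filter_upwards [h_notMem, h_ne] with x hx hx0 hxV
      exact hx ⟨hxV, hx0⟩
    · by_cases hV0 : (0 : ℂ) ∈ V
      · exact .inl (h_eq.mono fun x hx => by rwa [not_not.1 hx])
      · exact .inr (h_eq.mono fun x hx => by rwa [not_not.1 hx])
  obtain ⟨c, hc⟩ := exists_eventuallyEq_const_of_forall_separating IsOpen trivial_of_isOpen
  have eq_const : f = Lp.const 2 μ c := Lp.ext (hc.trans (Lp.coeFn_const 2 μ c).symm)
  exact Submodule.mem_span_singleton.2 ⟨c, by rw [smul_const_one, eq_const]⟩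

end Koopman

section Centered

variable {X : Type*} [MeasurableSpace X] {μ : Measure X}

theorem ae_eq_empty_or_ae_eq_univ_of_indicatorConstLp_mem_span [IsFiniteMeasure μ] {B : Set X}
    {hB : MeasurableSet B}
    (h : indicatorConstLp 2 hB (measure_ne_top μ B) (1 : ℂ) ∈
      Submodule.span ℂ {Lp.const 2 μ (1 : ℂ)}) :
    B =ᵐ[μ] (∅ : Set X) ∨ B =ᵐ[μ] (Set.univ : Set X) := by
  obtain ⟨c, hc⟩ := Submodule.mem_span_singleton.1 h
  have indicator_eq : B.indicator (fun _ => (1 : ℂ)) =ᵐ[μ] fun _ => c := by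
    have coeFn_indicator :=
      indicatorConstLp_coeFn (p := 2) (hs := hB) (hμs := measure_ne_top μ B) (c := (1 : ℂ))
    rw [← hc, smul_const_one] at coeFn_indicator
    exact coeFn_indicator.symm.trans (Lp.coeFn_const 2 μ c)
  rcases eq_or_ne c 0 with rfl | hc0
  · exact .inl (eventuallyEq_empty.2 (indicator_eq.mono fun x hx hxB => by
      simp [Set.indicator_of_mem hxB] at hx))
  · exact .inr (eventuallyEq_univ.2 (indicator_eq.mono fun x hx =>
      Set.mem_of_indicator_ne_zero (hx.trans_ne hc0)))

/-- The orthogonal projection of `L²(X, μ)` onto the functions of mean zero. -/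
noncomputable def centered [IsFiniteMeasure μ] : Lp ℂ 2 μ →L[ℂ] Lp ℂ 2 μ :=
  (Submodule.span ℂ {Lp.const 2 μ (1 : ℂ)})ᗮ.starProjection

theorem centered_centered [IsFiniteMeasure μ] (f : Lp ℂ 2 μ) :
    centered (centered f) = centered f :=
  Submodule.starProjection_eq_self_iff.2 (Submodule.starProjection_apply_mem _ f)

theorem inner_centered_right [IsFiniteMeasure μ] (f g : Lp ℂ 2 μ) :
    inner ℂ f (centered g) = inner ℂ (centered f) g :=
  (Submodule.inner_starProjection_left_eq_right _ f g).symm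

theorem centered_eq_zero_iff [IsFiniteMeasure μ] {f : Lp ℂ 2 μ} :
    centered f = 0 ↔ f ∈ Submodule.span ℂ {Lp.const 2 μ (1 : ℂ)} := by
  rw [centered, Submodule.starProjection_apply_eq_zero_iff, Submodule.orthogonal_orthogonal]

theorem centered_apply [IsProbabilityMeasure μ] (f : Lp ℂ 2 μ) :
    centered f = f - inner ℂ (Lp.const 2 μ (1 : ℂ)) f • Lp.const 2 μ (1 : ℂ) := by
  have norm_one : ‖Lp.const 2 μ (1 : ℂ)‖ = 1 := by
    simp [Lp.norm_const (p := 2) (μ := μ) (c := (1 : ℂ)) two_ne_zero]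
  rw [centered, Submodule.starProjection_orthogonal_val,
    Submodule.starProjection_unit_singleton ℂ norm_one]

end Centered

section WeakMixing

variable {X : Type*} [TopologicalSpace X] [MeasurableSpace X] [BorelSpace X]
  {T : ZTwoAction X} {μ : Measure X} [IsProbabilityMeasure μ] {hμ : IsInvariant T μ}
  {β b₀ b : ℝ}

theorem koopman_centered (p : ℤ × ℤ) (f : Lp ℂ 2 μ) :
    koopman hμ p (centered f) = centered (koopman hμ p f) := by
  rw [centered_apply, centered_apply, map_sub, map_smul, koopman_const,
    ← (koopman hμ p).inner_map_map (Lp.const 2 μ 1) f, koopman_const]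

theorem pairing_koopman_sub (p : ℤ × ℤ) (f g : Lp ℂ 2 μ) :
    pairing (koopman hμ p f) g - pairing f (Lp.const 2 μ (1 : ℂ)) *
      pairing (Lp.const 2 μ (1 : ℂ)) g = inner ℂ g (koopman hμ p (centered f)) := by
  rw [centered_apply, map_sub, map_smul, koopman_const, inner_sub_right, inner_smul_right]
  rfl

theorem inner_koopman_centered (p : ℤ × ℤ) (f : Lp ℂ 2 μ) :
    inner ℂ f (koopman hμ p (centered f)) =
      inner ℂ (centered f) (koopman hμ p (centered f)) := by
  rw [← inner_centered_right, ← koopman_centered, centered_centered]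

theorem IsDirWeakMixing.tendsto_stripAverage_self (h : IsDirWeakMixing hμ β b₀) (hb : 0 < b)
    (f : Lp ℂ 2 μ) :
    Tendsto (stripAverage β b fun p => ‖inner ℂ f (koopman hμ p (centered f))‖) atTop (𝓝 0) := by
  simp only [inner_koopman_centered, norm_inner_symm (centered f)]
  refine tendsto_stripAverage_norm_inner_self (U := koopmanRep hμ) (b₀ := b₀) hb fun y hy => ?_
  rw [inner_centered_right, centered_eq_zero_iff.2 (h.mem_span_const hy), inner_zero_left]

theorem isDirWeakMixing_of_forall_tendsto_stripAverage (hb₀ : 0 < b₀) (hb : 0 < b)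
    (h : ∀ f g : Lp ℂ 2 μ, Tendsto (stripAverage β b fun p =>
      ‖inner ℂ g (koopman hμ p (centered f))‖) atTop (𝓝 0)) : IsDirWeakMixing hμ β b₀ := by
  intro B hBK
  obtain ⟨hB, almostPeriodic⟩ := mem_kroneckerAlgebra_iff.1 hBK
  obtain ⟨F, hF⟩ := exists_finset_strip_subset_add β b hb₀
  have centered_almostPeriodic : IsAlmostPeriodicOn (koopmanRep hμ) (strip β b)
      (centered (indicatorConstLp 2 hB (measure_ne_top μ B) (1 : ℂ))) :=
    (almostPeriodic.of_subset_add hF).map centered.uniformContinuous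
      fun p _ => koopman_centered (hμ := hμ) p _
  exact ae_eq_empty_or_ae_eq_univ_of_indicatorConstLp_mem_span (centered_eq_zero_iff.1
    (centered_almostPeriodic.eq_zero_of_forall_tendsto hb.le (h _)))

end WeakMixing

theorem mainTheorem10_general {X : Type*} [TopologicalSpace X] [MeasurableSpace X] [BorelSpace X]
    (T : ZTwoAction X) (μ : Measure X) [IsProbabilityMeasure μ] (hμ : IsInvariant T μ)
    (β b₀ b : ℝ) (hb₀ : 0 < b₀) (hb : 0 < b) :
    List.TFAE [
      IsDirWeakMixing hμ β b₀,
      ∀ f : Lp ℂ 2 μ, Tendsto (stripAverage β b (fun p =>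
        ‖pairing (koopman hμ p f) f
          - pairing f (Lp.const 2 μ (1 : ℂ)) * pairing (Lp.const 2 μ (1 : ℂ)) f‖)) atTop (𝓝 0),
      ∀ f g : Lp ℂ 2 μ, Tendsto (stripAverage β b (fun p =>
        ‖pairing (koopman hμ p f) g
          - pairing f (Lp.const 2 μ (1 : ℂ)) * pairing (Lp.const 2 μ (1 : ℂ)) g‖))
        atTop (𝓝 0)] := by
  simp only [pairing_koopman_sub]
  tfae_have 1 → 2 := fun h f => h.tendsto_stripAverage_self hb f
  tfae_have 2 → 3 := tendsto_stripAverage_norm_inner_of_forall_self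
    (A := fun p => (koopman hμ p).toLinearMap ∘ₗ centered.toLinearMap)
  tfae_have 3 → 1 := isDirWeakMixing_of_forall_tendsto_stripAverage hb₀ hb
  tfae_finish

end DirectionalWeakMixing

theorem mainTheorem10 {X : Type*} [MetricSpace X] [CompactSpace X] [MeasurableSpace X]
    [BorelSpace X] (T : DirectionalWeakMixing.ZTwoAction X) (μ : Measure X)
    [IsProbabilityMeasure μ] (hμ : DirectionalWeakMixing.IsInvariant T μ)
    (β : ℝ) (b₀ b : ℝ) (hb₀ : 0 < b₀) (hb : 0 < b) :
    List.TFAE [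
      DirectionalWeakMixing.IsDirWeakMixing hμ β b₀,
      ∀ f : Lp ℂ 2 μ, Tendsto (DirectionalWeakMixing.stripAverage β b (fun p =>
        ‖DirectionalWeakMixing.pairing (DirectionalWeakMixing.koopman hμ p f) f
          - DirectionalWeakMixing.pairing f (Lp.const 2 μ (1 : ℂ))
            * DirectionalWeakMixing.pairing (Lp.const 2 μ (1 : ℂ)) f‖)) atTop (𝓝 0),
      ∀ f g : Lp ℂ 2 μ, Tendsto (DirectionalWeakMixing.stripAverage β b (fun p =>
        ‖DirectionalWeakMixing.pairing (DirectionalWeakMixing.koopman hμ p f) g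
          - DirectionalWeakMixing.pairing f (Lp.const 2 μ (1 : ℂ))
            * DirectionalWeakMixing.pairing (Lp.const 2 μ (1 : ℂ)) g‖)) atTop (𝓝 0)] :=
  DirectionalWeakMixing.mainTheorem10_general T μ hμ β b₀ b hb₀ hb
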